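/- Let $\varrho$ be the quaternary Rudin--Shapiro substitution $0\mapsto 02,\ 1\mapsto 32,\ 2\mapsto 01,\ 3\mapsto 31$, and let $a|b\in\{2|0,\,2|3,\,1|0,\,1|3\}$ be a legal seed. Let $x\in\{0,1,2,3\}^{\mathbb{Z}}$ be the bi-infinite fixed point of $\varrho^2$ with $x_{-1}=a$ and $x_0=b$, and let $w=(w_i)_{i\in\mathbb{Z}}$ be the corresponding balanced binary Rudin--Shapiro word, that is, $w_i=1$ if $x_i\in\{0,2\}$ and $w_i=-1$ if $x_i\in\{1,3\}$. For $m_1,m_2,m_3\in\mathbb{Z}$ put $$\eta^{(4)}(m_1,m_2,m_3)=\lim_{N\to\infty}\frac{1}{2N+1}\sum_{i=-N}^{N} w_i\,w_{i+m_1}w_{i+m_2}w_{i+m_3},$$ $$\theta^{(4)}(m_1,m_2,m_3)=\lim_{N\to\infty}\frac{1}{2N+1}\sum_{i=-N}^{N}(-1)^i\, w_i\,w_{i+m_1}w_{i+m_2}w_{i+m_3}.$$ Then for all $\ell\in\mathbb{Z}$ and all integers $m,n\ge 0$ the following limits exist and have the stated values, where $\delta_{m,0}$ is $1$ if $m=0$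 and $0$ otherwise: $$\eta^{(4)}\bigl(2^{m}(2,\,2^{n+2}(2\ell+1)+1,\,2^{n+2}(2\ell+1)+3)\bigr)=-\frac12+\frac{3}{2^{n+2}},$$ $$\theta^{(4)}\bigl(2^{m}(2,\,2^{n+2}(2\ell+1)+1,\,2^{n+2}(2\ell+1)+3)\bigr)=\delta_{m,0}\Bigl(-\frac12+\frac{3}{2^{n+2}}\Bigr),$$ $$\eta^{(4)}\bigl(2^{m}(2,\,2^{n+2}(2\ell+1)-1,\,2^{n+2}(2\ell+1)+1)\bigr)=-\frac12+\frac{3}{2^{n+2}},$$ $$\theta^{(4)}\bigl(2^{m}(2,\,2^{n+2}(2\ell+1)-1,\,2^{n+2}(2\ell+1)+1)\bigr)=-\delta_{m,0}\Bigl(-\frac12+\frac{3}{2^{n+2}}\Bigr).$$ -/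

import Mathlib

open Filter Topology

namespace RudinShapiro

/-- The quaternary Rudin–Shapiro substitution
`0 ↦ 02`, `1 ↦ 32`, `2 ↦ 01`, `3 ↦ 31`. -/
def subst : Fin 4 → Fin 2 → Fin 4 :=
  ![![0, 2], ![3, 2], ![0, 1], ![3, 1]]

/-- The square of the substitution, of constant length four: the letter at position `2 p + q` of the
image of `a` is the letter at position `q` of the image of the letter at position `p` of
`subst a`. -/
def substSq (a : Fin 4) : Fin 4 → Fin 4 :=
  ![subst (subst a 0) 0, subst (subst a 0) 1, subst (subst a 1) 0, subst (subst a 1) 1]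

/-- The residue of an integer modulo `4`, as an index of a letter in a block of length four. -/
def digit (i : ℤ) : Fin 4 := ⟨(i % 4).toNat, by omega⟩

/-- The bi-infinite quaternary word with letter `a` at position `-1` and letter `b` at position `0`
that is generated from this seed by the square of the substitution: the block at the positions
`4 m, 4 m + 1, 4 m + 2, 4 m + 3` is the image of the letter at position `m`. -/
def quaternaryWord (a b : Fin 4) (i : ℤ) : Fin 4 :=
  if i = 0 then b
  else if i = -1 then a
  else substSq (quaternaryWord a b (i / 4)) (digit i)
termination_by i.natAbs
decreasing_by omega

/-- A seed `a|b` is legal if it is one of `2|0`, `2|3`, `1|0`, `1|3`. -/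
def IsLegalSeed (a b : Fin 4) : Prop :=
  (a = 2 ∨ a = 1) ∧ (b = 0 ∨ b = 3)

/-- For a legal seed, the word is a fixed point of the square of the substitution (at all
positions, those of the seed included). -/
theorem quaternaryWord_fixed {a b : Fin 4} (h : IsLegalSeed a b) (m : ℤ) (j : Fin 4) :
    quaternaryWord a b (4 * m + (j : ℕ)) = substSq (quaternaryWord a b m) j := by
  have hq : (4 * m + ((j : ℕ) : ℤ)) / 4 = m := by omega
  have hd : digit (4 * m + ((j : ℕ) : ℤ)) = j := by
    apply Fin.ext
    simp only [digit]
    omega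
  by_cases h0 : 4 * m + ((j : ℕ) : ℤ) = 0
  · have hm : m = 0 := by omega
    have hj : j = 0 := Fin.ext (by simp only [Fin.val_zero]; omega)
    subst hm hj
    obtain ⟨-, rfl | rfl⟩ := h <;> simp [quaternaryWord] <;> rfl
  · by_cases h1 : 4 * m + ((j : ℕ) : ℤ) = -1
    · have hm : m = -1 := by omega
      have hj : j = 3 := Fin.ext (by change (j : ℕ) = 3; omega)
      subst hm hj
      rw [h1]
      obtain ⟨rfl | rfl, -⟩ := h <;> simp [quaternaryWord] <;> rfl
    · rw [quaternaryWord, if_neg h0, if_neg h1, hq, hd]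

/-- The weights of the letters: `0` and `2` have weight `1`, while `1` and `3` have weight `-1`. -/
def weight : Fin 4 → ℝ := ![1, -1, 1, -1]

/-- The balanced binary Rudin–Shapiro word over `{1, -1}` with the seed `a|b`. -/
def word (a b : Fin 4) (i : ℤ) : ℝ := weight (quaternaryWord a b i)

/-- `HasEta w m v` says that the correlation
`η(m₁, …, m_k) = lim_{N → ∞} (2 N + 1)⁻¹ ∑_{i = -N}^{N} w_i w_{i + m₁} ⋯ w_{i + m_k}`
of the word `w` (with `k + 1` points) exists and is equal to `v`. -/
def HasEta (w : ℤ → ℝ) {k : ℕ} (m : Fin k → ℤ) (v : ℝ) : Prop :=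
  Tendsto (fun N : ℕ => 1 / (2 * (N : ℝ) + 1) *
    ∑ i ∈ Finset.Icc (-(N : ℤ)) (N : ℤ), w i * ∏ j, w (i + m j)) atTop (𝓝 v)

/-- `HasTheta w m v` says that the signed correlation
`θ(m₁, …, m_k) = lim_{N → ∞} (2 N + 1)⁻¹ ∑_{i = -N}^{N} (-1)^i w_i w_{i + m₁} ⋯ w_{i + m_k}`
of the word `w` (with `k + 1` points) exists and is equal to `v`. -/
def HasTheta (w : ℤ → ℝ) {k : ℕ} (m : Fin k → ℤ) (v : ℝ) : Prop :=
  Tendsto (fun N : ℕ => 1 / (2 * (N : ℝ) + 1) *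
    ∑ i ∈ Finset.Icc (-(N : ℤ)) (N : ℤ), (-1 : ℝ) ^ i * (w i * ∏ j, w (i + m j))) atTop (𝓝 v)

end RudinShapiro

/-! Let p(i) = w(i) w(i+1) (`pair`). The substitution gives p(2i) = (-1)^i and, for i ≠ -1, p(2i+1)
= (-1)^i p(i). Splitting by parity, p has mean 0, and the mean A(c) of p(i) p(i+c) satisfies A(c) =
0 for odd c and A(2c) = (-1)^c (1 + A(c))/2, which yields the closed form in
`hasMean_pair_mul_pair`.

For shifts (2, 4K+1, 4K+3) the fourfold product on the residue classes of the position modulo 4 is,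
up to sign, 1, p(i+K), p(i) p(i+K) and p(i). The odd positions average to 0, so η = θ = -(-1)^K (1 +
A(K))/4 (`hasMean_corr`, `hasMean_neg_one_zpow_mul_corr`). Doubling the shifts preserves η and makes
θ vanish, whence the factor δ. The second family is a translate, by an odd distance, of the first
with ℓ replaced by -ℓ-1; the odd distance flips the sign of θ. -/

namespace RudinShapiro

/-! ### Means over symmetric intervals. -/

/-- The sequence `f` has mean `v` along the symmetric intervals `[-N, N]`. -/
def HasMean (f : ℤ → ℝ) (v : ℝ) : Prop :=
  Tendsto (fun N : ℕ => 1 / (2 * (N : ℝ) + 1) *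
    ∑ i ∈ Finset.Icc (-(N : ℤ)) (N : ℤ), f i) atTop (𝓝 v)

/-- The sum of `f` over the symmetric interval `[-N, N]`. -/
noncomputable def symSum (f : ℤ → ℝ) (N : ℕ) : ℝ := ∑ i ∈ Finset.Icc (-(N : ℤ)) (N : ℤ), f i

theorem symSum_zero (f : ℤ → ℝ) : symSum f 0 = f 0 := by simp [symSum]

theorem symSum_succ (f : ℤ → ℝ) (N : ℕ) :
    symSum f (N + 1) = symSum f N + f (N + 1) + f (-(N + 1)) := by
  have h : Finset.Icc (-((N + 1 : ℕ) : ℤ)) ((N + 1 : ℕ) : ℤ) =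
      insert ((N : ℤ) + 1) (insert (-((N : ℤ) + 1)) (Finset.Icc (-(N : ℤ)) (N : ℤ))) := by
    ext i
    simp only [Finset.mem_Icc, Finset.mem_insert]
    omega
  rw [symSum, h, Finset.sum_insert, Finset.sum_insert, symSum]
  · ring
  · simp
  · simp only [Finset.mem_Icc, Finset.mem_insert]
    omega

/-- The odd numbers 2i+1 with |i| ≤ M run up to 2M+1, one term beyond the interval; hence the
subtraction. -/
theorem symSum_two_mul (f : ℤ → ℝ) (M : ℕ) :
    symSum f (2 * M) =
      symSum (fun i => f (2 * i)) M + symSum (fun i => f (2 * i + 1)) M - f (2 * M + 1) := by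
  induction M with
  | zero => simp [symSum_zero]
  | succ M ih =>
    rw [show 2 * (M + 1) = 2 * M + 1 + 1 by ring, symSum_succ, symSum_succ, ih, symSum_succ,
      symSum_succ]
    have e1 : ((2 * M + 1 : ℕ) : ℤ) + 1 = 2 * ((M : ℤ) + 1) := by push_cast; ring
    have e2 : ((2 * M : ℕ) : ℤ) + 1 = 2 * (M : ℤ) + 1 := by push_cast; ring
    have e3 : -(2 * ((M : ℤ) + 1)) = 2 * (-((M : ℤ) + 1)) := by ring
    have e4 : -(2 * (M : ℤ) + 1) = 2 * (-((M : ℤ) + 1)) + 1 := by ring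
    rw [e1, e2, e3, e4]
    push_cast
    ring

theorem abs_symSum_sub_halves_le {f : ℤ → ℝ} {C : ℝ} (hf : ∀ i, |f i| ≤ C) (N : ℕ) :
    |symSum f N - (symSum (fun i => f (2 * i)) (N / 2) +
      symSum (fun i => f (2 * i + 1)) (N / 2))| ≤ 3 * C := by
  have hC : 0 ≤ C := (abs_nonneg _).trans (hf 0)
  obtain ⟨M, rfl | rfl⟩ := Nat.even_or_odd' N
  · rw [symSum_two_mul, Nat.mul_div_cancel_left _ two_pos, sub_sub_cancel_left, abs_neg]
    exact (hf _).trans (by linarith)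
  · rw [symSum_succ, symSum_two_mul, show (2 * M + 1) / 2 = M by omega]
    have h1 := abs_le.1 (hf (2 * M + 1))
    have h2 := abs_le.1 (hf ((2 * M : ℕ) + 1))
    have h3 := abs_le.1 (hf (-((2 * M : ℕ) + 1)))
    rw [abs_le]
    constructor <;> linarith [h1.1, h1.2, h2.1, h2.2, h3.1, h3.2]

theorem tendsto_one_div_two_mul_add_one :
    Tendsto (fun N : ℕ => 1 / (2 * (N : ℝ) + 1)) atTop (𝓝 0) := by
  have h : Tendsto (fun N : ℕ => 2 * (N : ℝ) + 1) atTop atTop :=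
    tendsto_atTop_add_const_right _ _
      (tendsto_natCast_atTop_atTop.const_mul_atTop two_pos)
  exact h.inv_tendsto_atTop.congr fun N => by simp

theorem hasMean_const (c : ℝ) : HasMean (fun _ => c) c := by
  refine tendsto_const_nhds.congr fun N => ?_
  have : (2 * (N : ℝ) + 1) ≠ 0 := by positivity
  have h : ((N : ℤ) + 1 - -(N : ℤ)).toNat = 2 * N + 1 := by omega
  rw [Finset.sum_const, Int.card_Icc, h, nsmul_eq_mul]
  push_cast
  field_simp

theorem HasMean.mul_left {f : ℤ → ℝ} {v : ℝ} (h : HasMean f v) (c : ℝ) :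
    HasMean (fun i => c * f i) (c * v) := by
  refine (Tendsto.const_mul c h).congr fun N => ?_
  rw [← Finset.mul_sum]
  ring

theorem HasMean.add {f g : ℤ → ℝ} {v u : ℝ} (hf : HasMean f v) (hg : HasMean g u) :
    HasMean (fun i => f i + g i) (v + u) := by
  refine (Tendsto.add hf hg).congr fun N => ?_
  rw [Finset.sum_add_distrib]
  ring

theorem hasMean_zero_of_symSum_bounded {f : ℤ → ℝ} {C : ℝ} (h : ∀ N, |symSum f N| ≤ C) :
    HasMean f 0 := by
  have := tendsto_one_div_two_mul_add_one.mul_const C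
  rw [zero_mul] at this
  refine squeeze_zero_norm (fun N => ?_) this
  rw [norm_mul, Real.norm_of_nonneg (by positivity)]
  exact mul_le_mul_of_nonneg_left (h N) (by positivity)

theorem hasMean_zero_of_finite {f : ℤ → ℝ} (s : Finset ℤ) (h : ∀ i, i ∉ s → f i = 0) :
    HasMean f 0 := by
  refine hasMean_zero_of_symSum_bounded (C := ∑ i ∈ s, |f i|) fun N => ?_
  refine (Finset.abs_sum_le_sum_abs _ _).trans ?_
  rw [← Finset.sum_filter_of_ne (p := fun i => i ∈ s)]
  · exact Finset.sum_le_sum_of_subset_of_nonneg (fun i hi => (Finset.mem_filter.1 hi).2)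
      fun _ _ _ => abs_nonneg _
  · intro i _ hi
    by_contra hs
    exact hi (by rw [h i hs, abs_zero])

/-- This absorbs the finitely many positions near the origin where the two halves of the word
interact. -/
theorem HasMean.congr_off {f g : ℤ → ℝ} {v : ℝ} (hg : HasMean g v) (s : Finset ℤ)
    (h : ∀ i, i ∉ s → f i = g i) : HasMean f v := by
  have := hg.add (hasMean_zero_of_finite (f := fun i => f i - g i) s
    fun i hi => sub_eq_zero.2 (h i hi))
  simpa using this

theorem HasMean.congr {f g : ℤ → ℝ} {v : ℝ} (hg : HasMean g v) (h : ∀ i, f i = g i) :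
    HasMean f v :=
  hg.congr_off ∅ fun i _ => h i

/-- The main computational tool: boundedness makes the boundary terms negligible, and each half
fills a proportion tending to 1/2. -/
theorem HasMean.of_halves {f : ℤ → ℝ} {v u C : ℝ} (hf : ∀ i, |f i| ≤ C)
    (h0 : HasMean (fun i => f (2 * i)) v) (h1 : HasMean (fun i => f (2 * i + 1)) u) :
    HasMean f ((v + u) / 2) := by
  have hdiv : Tendsto (fun N : ℕ => N / 2) atTop atTop :=
    Nat.tendsto_div_const_atTop two_ne_zero
  have hratio : Tendsto (fun N : ℕ => (2 * ((N / 2 : ℕ) : ℝ) + 1) * (1 / (2 * (N : ℝ) + 1)))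
      atTop (𝓝 (1 / 2)) := by
    have hb : Tendsto (fun N : ℕ => (1 / 2 : ℝ) -
        (2 * ((N / 2 : ℕ) : ℝ) + 1) * (1 / (2 * (N : ℝ) + 1))) atTop (𝓝 0) := by
      refine squeeze_zero_norm (fun N => ?_) tendsto_one_div_two_mul_add_one
      have hpos : 0 < 2 * (N : ℝ) + 1 := by positivity
      have e : (1 / 2 : ℝ) - (2 * ((N / 2 : ℕ) : ℝ) + 1) * (1 / (2 * (N : ℝ) + 1)) =
          (N - 1 / 2 - 2 * ((N / 2 : ℕ) : ℝ)) * (1 / (2 * (N : ℝ) + 1)) := by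
        field_simp
        ring
      rw [e, norm_mul, Real.norm_of_nonneg (r := 1 / _) (by positivity)]
      refine mul_le_of_le_one_left (by positivity) ?_
      have l1 : 2 * ((N / 2 : ℕ) : ℝ) ≤ N := by exact_mod_cast Nat.mul_div_le N 2
      have l2 : (N : ℝ) ≤ 2 * ((N / 2 : ℕ) : ℝ) + 1 := by
        exact_mod_cast (by omega : N ≤ 2 * (N / 2) + 1)
      rw [Real.norm_eq_abs, abs_le]
      constructor <;> linarith
    simpa using (tendsto_const_nhds (x := (1 / 2 : ℝ))).sub hb
  have hmain := hratio.mul ((h0.comp hdiv).add (h1.comp hdiv))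
  have herr : Tendsto (fun N : ℕ => 1 / (2 * (N : ℝ) + 1) *
      (symSum f N - (symSum (fun i => f (2 * i)) (N / 2) +
      symSum (fun i => f (2 * i + 1)) (N / 2)))) atTop (𝓝 0) := by
    have := tendsto_one_div_two_mul_add_one.mul_const (3 * C)
    rw [zero_mul] at this
    refine squeeze_zero_norm (fun N => ?_) this
    rw [norm_mul, Real.norm_of_nonneg (by positivity)]
    exact mul_le_mul_of_nonneg_left (abs_symSum_sub_halves_le hf N) (by positivity)
  have := hmain.add herr
  rw [show 1 / 2 * (v + u) + 0 = (v + u) / 2 by ring] at this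
  refine this.congr fun N => ?_
  have p1 : (2 * ((N / 2 : ℕ) : ℝ) + 1) ≠ 0 := by positivity
  simp only [Function.comp, symSum]
  field_simp
  ring

theorem symSum_shift (f : ℤ → ℝ) (N : ℕ) :
    symSum (fun i => f (i + 1)) N = symSum f N + f (N + 1) - f (-N) := by
  induction N with
  | zero => simp [symSum_zero]
  | succ N ih =>
    rw [symSum_succ, ih, symSum_succ]
    have e : -((N : ℤ) + 1) + 1 = -N := by ring
    rw [e]
    push_cast
    ring

/-- The sum telescopes to two boundary values. -/
theorem hasMean_shift_one_sub {f : ℤ → ℝ} {C : ℝ} (hf : ∀ i, |f i| ≤ C) :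
    HasMean (fun i => f (i + 1) - f i) 0 := by
  refine hasMean_zero_of_symSum_bounded (C := 2 * C) fun N => ?_
  have : symSum (fun i => f (i + 1) - f i) N = f (N + 1) - f (-N) := by
    have := symSum_shift f N
    simp only [symSum, Finset.sum_sub_distrib] at this ⊢
    linarith
  rw [this]
  exact (abs_sub _ _).trans (by linarith [hf (N + 1), hf (-N)])

theorem HasMean.shift {f : ℤ → ℝ} {v C : ℝ} (hf : ∀ i, |f i| ≤ C) (h : HasMean f v) (c : ℤ) :
    HasMean (fun i => f (i + c)) v := by
  induction c using Int.induction_on with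
  | zero => simpa using h
  | succ k ih =>
    have := ih.add (hasMean_shift_one_sub (f := fun i => f (i + k)) fun i => hf _)
    rw [add_zero] at this
    refine this.congr fun i => ?_
    rw [show i + ((k : ℤ) + 1) = i + 1 + k by ring]
    ring
  | pred k ih =>
    have := ih.add ((hasMean_shift_one_sub (f := fun i => f (i + (-k - 1)))
      fun i => hf _).mul_left (-1))
    rw [mul_zero, add_zero] at this
    refine this.congr fun i => ?_
    rw [show i + 1 + (-(k : ℤ) - 1) = i + -k by ring]
    ring

/-- `HasMean.of_halves` presupposes that the means of the halves exist, so a self-referential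
recursion needs this a priori bound instead. -/
theorem hasMean_zero_of_symSum_le_log {f : ℤ → ℝ} {C : ℝ}
    (h : ∀ N, |symSum f N| ≤ C * (Nat.log 2 N + 1)) : HasMean f 0 := by
  have hlog : Tendsto (fun N : ℕ => C * ((Nat.log 2 N + 1 : ℝ) / (2 * (N : ℝ) + 1)))
      atTop (𝓝 0) := by
    have h1 : Tendsto (fun N : ℕ => Real.log N / N) atTop (𝓝 0) :=
      (Real.isLittleO_log_id_atTop.tendsto_div_nhds_zero).comp tendsto_natCast_atTop_atTop
    have h2 : Tendsto (fun N : ℕ => (1 / Real.log 2) * (Real.log N / N) + 1 / (2 * (N : ℝ) + 1))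
        atTop (𝓝 0) := by
      simpa using (h1.const_mul (1 / Real.log 2)).add tendsto_one_div_two_mul_add_one
    have h3 : Tendsto (fun N : ℕ => (Nat.log 2 N + 1 : ℝ) / (2 * (N : ℝ) + 1)) atTop (𝓝 0) := by
      refine squeeze_zero' (Eventually.of_forall fun N => by positivity) ?_ h2
      filter_upwards [eventually_ge_atTop 1] with N hN
      have hN' : (1 : ℝ) ≤ N := by exact_mod_cast hN
      have hl : (Nat.log 2 N : ℝ) ≤ Real.log N / Real.log 2 := by
        simpa [Real.logb] using Real.natLog_le_logb N 2
      rw [add_div]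
      refine add_le_add_left ?_ _
      have e : 1 / Real.log 2 * (Real.log N / N) = Real.log N / Real.log 2 / N := by ring
      rw [e]
      refine div_le_div₀ ((Nat.cast_nonneg _).trans hl) hl (by linarith) (by linarith)
    simpa using h3.const_mul C
  refine squeeze_zero_norm (fun N => ?_) hlog
  rw [norm_mul, Real.norm_of_nonneg (by positivity), ← mul_div_assoc, one_div_mul_eq_div]
  exact div_le_div_of_nonneg_right (h N) (by positivity)

theorem neg_one_zpow_mul_self (i : ℤ) : (-1 : ℝ) ^ i * (-1) ^ i = 1 := by
  obtain h | h := Int.even_or_odd i <;> simp [h.neg_one_zpow]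

theorem neg_one_zpow_add (i j : ℤ) : (-1 : ℝ) ^ (i + j) = (-1) ^ i * (-1) ^ j :=
  zpow_add₀ (by norm_num) i j

theorem neg_one_zpow_add_one (i : ℤ) : (-1 : ℝ) ^ (i + 1) = -(-1) ^ i := by
  rw [neg_one_zpow_add, zpow_one, mul_neg_one]

theorem neg_one_zpow_two_mul (i : ℤ) : (-1 : ℝ) ^ (2 * i) = 1 :=
  (even_two_mul i).neg_one_zpow

theorem neg_one_zpow_two_mul_add_one (i : ℤ) : (-1 : ℝ) ^ (2 * i + 1) = -1 :=
  (odd_two_mul_add_one i).neg_one_zpow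

theorem hasMean_neg_one_zpow : HasMean (fun i => (-1 : ℝ) ^ i) 0 := by
  have := HasMean.of_halves (f := fun i => (-1 : ℝ) ^ i) (fun i => (abs_neg_one_zpow i).le)
    ((hasMean_const 1).congr neg_one_zpow_two_mul)
    ((hasMean_const (-1)).congr neg_one_zpow_two_mul_add_one)
  simpa using this

/-! ### Recursions for the word modulo 4 and modulo 2. -/

section word

variable {a b : Fin 4}

/-- The letters `0` and `3` occupy exactly the even positions. -/
theorem quaternaryWord_parity (h : IsLegalSeed a b) (i : ℤ) :
    Even i ↔ quaternaryWord a b i = 0 ∨ quaternaryWord a b i = 3 := by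
  have key : ∀ (c j : Fin 4), (substSq c j = 0 ∨ substSq c j = 3) ↔ (j : ℕ) % 2 = 0 := by decide
  obtain ⟨m, j, rfl⟩ : ∃ (m : ℤ) (j : Fin 4), i = 4 * m + (j : ℕ) :=
    ⟨i / 4, digit i, by simp only [digit]; omega⟩
  rw [quaternaryWord_fixed h, key, Int.even_iff]
  omega

theorem word_mul_self (i : ℤ) : word a b i * word a b i = 1 := by
  simp only [word]
  generalize quaternaryWord a b i = c
  fin_cases c <;> simp [weight]

theorem abs_word (i : ℤ) : |word a b i| = 1 := by
  obtain h | h := mul_self_eq_one_iff.1 (word_mul_self (a := a) (b := b) i) <;> simp [h]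

theorem word_four_mul (h : IsLegalSeed a b) (i : ℤ) : word a b (4 * i) = word a b i := by
  have := quaternaryWord_fixed h i 0
  simp only [Fin.val_zero, Nat.cast_zero, add_zero] at this
  simp only [word, this]
  generalize quaternaryWord a b i = c
  fin_cases c <;> simp [weight, substSq, subst]

theorem word_four_mul_add_one (h : IsLegalSeed a b) (i : ℤ) :
    word a b (4 * i + 1) = word a b i := by
  have : quaternaryWord a b (4 * i + 1) = _ := quaternaryWord_fixed h i 1
  simp only [word, this]
  generalize quaternaryWord a b i = c
  fin_cases c <;> simp [weight, substSq, subst]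

/-- In the last half of a block the sign relative to w(i) depends on whether the letter lies in {0,
3} or {1, 2}, which is the parity of i. -/
theorem word_four_mul_add_two (h : IsLegalSeed a b) (i : ℤ) :
    word a b (4 * i + 2) = (-1) ^ i * word a b i := by
  have : quaternaryWord a b (4 * i + 2) = _ := quaternaryWord_fixed h i 2
  have hp := quaternaryWord_parity h i
  simp only [word, this]
  obtain hi | hi := Int.even_or_odd i
  · rw [hi.neg_one_zpow]
    obtain hc | hc := hp.1 hi <;> rw [hc] <;> simp [weight, substSq, subst]
  · rw [hi.neg_one_zpow]
    have hn := mt hp.2 (Int.not_even_iff_odd.2 hi)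
    revert hn
    generalize quaternaryWord a b i = c
    fin_cases c <;> simp [weight, substSq, subst]

theorem word_four_mul_add_three (h : IsLegalSeed a b) (i : ℤ) :
    word a b (4 * i + 3) = -((-1) ^ i * word a b i) := by
  have : quaternaryWord a b (4 * i + 3) = _ := quaternaryWord_fixed h i 3
  have hp := quaternaryWord_parity h i
  simp only [word, this]
  obtain hi | hi := Int.even_or_odd i
  · rw [hi.neg_one_zpow]
    obtain hc | hc := hp.1 hi <;> rw [hc] <;> simp [weight, substSq, subst]
  · rw [hi.neg_one_zpow]
    have hn := mt hp.2 (Int.not_even_iff_odd.2 hi)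
    revert hn
    generalize quaternaryWord a b i = c
    fin_cases c <;> simp [weight, substSq, subst]

/-- The sign by which the substitution acts on the two halves of the word. -/
def halfSign (i : ℤ) : ℝ := if 0 ≤ i then 1 else -1

theorem halfSign_four_mul_add {i q : ℤ} (h0 : 0 ≤ q) (h1 : q < 4) :
    halfSign (4 * i + q) = halfSign i := by
  have : 0 ≤ 4 * i + q ↔ 0 ≤ i := by omega
  simp only [halfSign, this]

/-- The substitution itself keeps the right seeds 0 and 3 but exchanges the left seeds 1 and 2,
whose half-words are negatives of each other; this is the source of `halfSign`. -/
theorem word_two_mul_aux (h : IsLegalSeed a b) (k : ℕ) : ∀ i : ℤ, i.natAbs = k →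
    word a b (2 * i) = halfSign i * word a b i ∧
      word a b (2 * i + 1) = halfSign i * ((-1) ^ i * word a b i) := by
  induction k using Nat.strong_induction_on with
  | _ k ih =>
    intro i hi
    -- The positions 0 and -1 are fixed by i ↦ i / 4, so the induction does not descend there.
    by_cases h0 : i = 0
    · subst h0
      have := word_four_mul_add_one h 0
      simp only [mul_zero, zero_add] at this
      simp [halfSign, this]
    by_cases h1 : i = -1
    · subst h1
      have := word_four_mul_add_two h (-1)
      norm_num [halfSign] at this ⊢
      exact this
    obtain ⟨j, q, rfl, hq0, hq1⟩ : ∃ j q : ℤ, i = 4 * j + q ∧ 0 ≤ q ∧ q < 4 :=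
      ⟨i / 4, i % 4, by omega, by omega, by omega⟩
    obtain ⟨e, o⟩ := ih j.natAbs (by omega) j rfl
    rw [halfSign_four_mul_add hq0 hq1]
    have hj : (-1 : ℝ) ^ (4 * j) = 1 := by
      rw [show 4 * j = 2 * (2 * j) by ring, neg_one_zpow_two_mul]
    interval_cases q
    · rw [show 2 * (4 * j + 0) = 4 * (2 * j) by ring, word_four_mul h, word_four_mul_add_one h,
        add_zero, word_four_mul h, hj, e]
      simp
    · rw [show 2 * (4 * j + 1) + 1 = 4 * (2 * j) + 3 by ring,
        show 2 * (4 * j + 1) = 4 * (2 * j) + 2 by ring, word_four_mul_add_two h,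
        word_four_mul_add_three h, word_four_mul_add_one h, neg_one_zpow_add_one, hj, e,
        neg_one_zpow_two_mul]
      simp
    · rw [show 2 * (4 * j + 2) = 4 * (2 * j + 1) by ring, word_four_mul h,
        word_four_mul_add_one h, word_four_mul_add_two h,
        show 4 * j + 2 = 2 * (2 * j + 1) by ring, neg_one_zpow_two_mul, o]
      simp
    · rw [show 2 * (4 * j + 3) + 1 = 4 * (2 * j + 1) + 3 by ring,
        show 2 * (4 * j + 3) = 4 * (2 * j + 1) + 2 by ring, word_four_mul_add_two h,
        word_four_mul_add_three h, word_four_mul_add_three h,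
        show 4 * j + 3 = 2 * (2 * j + 1) + 1 by ring, neg_one_zpow_two_mul_add_one,
        neg_one_zpow_two_mul_add_one, o]
      constructor <;> ring

theorem word_two_mul (h : IsLegalSeed a b) (i : ℤ) :
    word a b (2 * i) = halfSign i * word a b i :=
  (word_two_mul_aux h _ i rfl).1

theorem word_two_mul_add_one (h : IsLegalSeed a b) (i : ℤ) :
    word a b (2 * i + 1) = halfSign i * ((-1) ^ i * word a b i) :=
  (word_two_mul_aux h _ i rfl).2

theorem halfSign_mul_self (i : ℤ) : halfSign i * halfSign i = 1 := by
  simp only [halfSign]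
  split_ifs <;> norm_num

theorem halfSign_add {i c : ℤ} (h : i ∉ Finset.Icc (-|c|) |c|) :
    halfSign (i + c) = halfSign i := by
  have : 0 ≤ i + c ↔ 0 ≤ i := by
    rw [Finset.mem_Icc] at h
    have := le_abs_self c
    have := neg_abs_le c
    omega
  simp only [halfSign, this]

/-! ### Products of consecutive letters and their mean. -/

/-- The product of two consecutive letters of the word. -/
noncomputable def pair (a b : Fin 4) (i : ℤ) : ℝ := word a b i * word a b (i + 1)

theorem abs_pair (i : ℤ) : |pair a b i| = 1 := by
  rw [pair, abs_mul, abs_word, abs_word, mul_one]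

theorem pair_two_mul (h : IsLegalSeed a b) (i : ℤ) : pair a b (2 * i) = (-1) ^ i := by
  rw [pair, word_two_mul h, word_two_mul_add_one h]
  linear_combination (-1) ^ i * word a b i * word a b i * halfSign_mul_self i +
    (-1) ^ i * word_mul_self (a := a) (b := b) i

/-- At i = -1 the pair straddles the origin and the two half signs differ. -/
theorem pair_two_mul_add_one (h : IsLegalSeed a b) {i : ℤ} (hi : i ≠ -1) :
    pair a b (2 * i + 1) = (-1) ^ i * pair a b i := by
  have hs : halfSign (i + 1) = halfSign i := by
    have : 0 ≤ i + 1 ↔ 0 ≤ i := by omega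
    simp only [halfSign, this]
  rw [pair, show 2 * i + 1 + 1 = 2 * (i + 1) by ring, word_two_mul h, word_two_mul_add_one h, hs,
    pair]
  linear_combination (-1) ^ i * word a b i * word a b (i + 1) * halfSign_mul_self i

theorem symSum_congr_off_singleton {f g : ℤ → ℝ} {C : ℝ} (c : ℤ) (hf : ∀ i, |f i| ≤ C)
    (hg : ∀ i, |g i| ≤ C) (h : ∀ i, i ≠ c → f i = g i) (N : ℕ) :
    |symSum f N - symSum g N| ≤ 2 * C := by
  have h0 : symSum f N - symSum g N =
      ∑ i ∈ Finset.Icc (-(N : ℤ)) N, if c = i then f c - g c else 0 := by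
    rw [symSum, symSum, ← Finset.sum_sub_distrib]
    refine Finset.sum_congr rfl fun i _ => ?_
    split_ifs with hc
    · rw [hc]
    · rw [h i (Ne.symm hc), sub_self]
  have hC : 0 ≤ C := (abs_nonneg _).trans (hf 0)
  rw [h0, Finset.sum_ite_eq]
  split_ifs
  · exact (abs_sub _ _).trans (by linarith [hf c, hg c])
  · simpa using hC

theorem symSum_const (c : ℝ) (N : ℕ) : symSum (fun _ => c) N = (2 * N + 1) * c := by
  induction N with
  | zero => simp [symSum_zero]
  | succ N ih => rw [symSum_succ, ih]; push_cast; ring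

theorem abs_symSum_neg_one_zpow_le (N : ℕ) : |symSum (fun i => (-1 : ℝ) ^ i) N| ≤ 3 := by
  have := abs_symSum_sub_halves_le (f := fun i => (-1 : ℝ) ^ i) (C := 1)
    (fun i => (abs_neg_one_zpow i).le) N
  simp only [neg_one_zpow_two_mul, neg_one_zpow_two_mul_add_one, symSum_const] at this
  rw [show (2 * ((N / 2 : ℕ) : ℝ) + 1) * 1 + (2 * ((N / 2 : ℕ) : ℝ) + 1) * -1 = 0 by ring,
    sub_zero, mul_one] at this
  exact this

theorem abs_neg_one_zpow_mul_pair (i : ℤ) : |(-1) ^ i * pair a b i| = 1 := by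
  rw [abs_mul, abs_neg_one_zpow, abs_pair, mul_one]

/-- With S(N) the sum, splitting by parity gives S(N) = -S(N/2) + O(1), so only about log N bounded
errors accumulate. The constant is 8 = 3 + 2 + 3: boundary terms, the exceptional position -1, and
the alternating sum over even positions. -/
theorem abs_symSum_neg_one_zpow_mul_pair_le (h : IsLegalSeed a b) (N : ℕ) :
    |symSum (fun i => (-1) ^ i * pair a b i) N| ≤ 8 * (Nat.log 2 N + 1) := by
  induction N using Nat.strong_induction_on with
  | _ N ih =>
    by_cases hN : N < 2
    · have hlog : Nat.log 2 N = 0 := Nat.log_of_lt hN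
      rw [hlog]
      have h1 := fun i => abs_le.1 (abs_neg_one_zpow_mul_pair (a := a) (b := b) i).le
      rw [abs_le]
      interval_cases N
      · rw [symSum_zero]
        constructor <;> push_cast <;> linarith [(h1 0).1, (h1 0).2]
      · rw [show (1 : ℕ) = 0 + 1 from rfl, symSum_succ, symSum_zero]
        have x := h1 0
        have y := h1 ((0 : ℕ) + 1)
        have z := h1 (-((0 : ℕ) + 1))
        constructor <;> push_cast at * <;> linarith [x.1, x.2, y.1, y.2, z.1, z.2]
    · have hlog : Nat.log 2 N = Nat.log 2 (N / 2) + 1 :=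
        Nat.log_of_one_lt_of_le one_lt_two (by omega)
      have h1 := abs_symSum_sub_halves_le (f := fun i => (-1) ^ i * pair a b i) (C := 1)
        (fun i => (abs_neg_one_zpow_mul_pair i).le) N
      have h2 := symSum_congr_off_singleton (f := fun i => (-1) ^ (2 * i + 1) * pair a b (2 * i + 1))
        (g := fun i => -((-1) ^ i * pair a b i)) (C := 1) (-1)
        (fun i => (abs_neg_one_zpow_mul_pair _).le)
        (fun i => by rw [abs_neg]; exact (abs_neg_one_zpow_mul_pair _).le)
        (fun i hi => by rw [neg_one_zpow_two_mul_add_one, pair_two_mul_add_one h hi]; ring) (N / 2)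
      have h3 := abs_symSum_neg_one_zpow_le (N / 2)
      have h4 := ih (N / 2) (by omega)
      have e1 : symSum (fun i => (-1) ^ (2 * i) * pair a b (2 * i)) (N / 2) =
          symSum (fun i => (-1) ^ i) (N / 2) := by
        simp only [neg_one_zpow_two_mul, pair_two_mul h, one_mul]
      have e2 : symSum (fun i => -((-1) ^ i * pair a b i)) (N / 2) =
          -symSum (fun i => (-1) ^ i * pair a b i) (N / 2) := by
        simp only [symSum, Finset.sum_neg_distrib]
      rw [e1] at h1
      rw [e2] at h2
      rw [hlog]
      push_cast
      rw [abs_le] at *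
      constructor <;> linarith [h1.1, h1.2, h2.1, h2.2, h3.1, h3.2, h4.1, h4.2]

theorem hasMean_neg_one_zpow_mul_pair (h : IsLegalSeed a b) :
    HasMean (fun i => (-1) ^ i * pair a b i) 0 :=
  hasMean_zero_of_symSum_le_log (abs_symSum_neg_one_zpow_mul_pair_le h)

theorem hasMean_pair (h : IsLegalSeed a b) : HasMean (pair a b) 0 := by
  have := HasMean.of_halves (f := pair a b) (fun i => (abs_pair i).le)
    (hasMean_neg_one_zpow.congr (pair_two_mul h))
    ((hasMean_neg_one_zpow_mul_pair h).congr_off {-1}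
      fun i hi => pair_two_mul_add_one h (by simpa using hi))
  simpa using this

/-! ### Two-point correlations of the pair sequence. -/

theorem abs_pair_mul_pair (K i : ℤ) : |pair a b i * pair a b (i + K)| ≤ 1 := by
  rw [abs_mul, abs_pair, abs_pair, mul_one]

/-- One of the two pairs always sits at an even position and is a mere sign; it cancels the sign of
the other up to a constant, leaving a single pair of mean 0. -/
theorem hasMean_pair_mul_pair_odd (h : IsLegalSeed a b) (c : ℤ) :
    HasMean (fun i => pair a b i * pair a b (i + (2 * c + 1))) 0 := by
  have h0 : HasMean (fun i => pair a b (2 * i) * pair a b (2 * i + (2 * c + 1))) 0 := by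
    have := (((hasMean_pair h).shift (fun i => (abs_pair i).le) c).mul_left ((-1) ^ c))
    rw [mul_zero] at this
    refine this.congr_off {-1 - c} fun i hi => ?_
    rw [pair_two_mul h, show 2 * i + (2 * c + 1) = 2 * (i + c) + 1 by ring,
      pair_two_mul_add_one h (by simp at hi; omega), neg_one_zpow_add]
    linear_combination (-1) ^ c * pair a b (i + c) * neg_one_zpow_mul_self i
  have h1 : HasMean (fun i => pair a b (2 * i + 1) * pair a b (2 * i + 1 + (2 * c + 1))) 0 := by
    have := (hasMean_pair h).mul_left (-(-1) ^ c)
    rw [mul_zero] at this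
    refine this.congr_off {-1} fun i hi => ?_
    rw [show 2 * i + 1 + (2 * c + 1) = 2 * (i + c + 1) by ring, pair_two_mul h,
      pair_two_mul_add_one h (by simpa using hi), neg_one_zpow_add_one, neg_one_zpow_add]
    linear_combination -(-1) ^ c * pair a b i * neg_one_zpow_mul_self i
  simpa using HasMean.of_halves (f := fun i => pair a b i * pair a b (i + (2 * c + 1)))
    (abs_pair_mul_pair _) h0 h1

/-- Even positions contribute the constant (-1)^c; odd positions reproduce the correlation at shift
c. -/
theorem hasMean_pair_mul_pair_even (h : IsLegalSeed a b) {c : ℤ} {v : ℝ}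
    (hv : HasMean (fun i => pair a b i * pair a b (i + c)) v) :
    HasMean (fun i => pair a b i * pair a b (i + 2 * c)) ((-1) ^ c * (1 + v) / 2) := by
  have h0 : HasMean (fun i => pair a b (2 * i) * pair a b (2 * i + 2 * c)) ((-1) ^ c) := by
    refine (hasMean_const _).congr fun i => ?_
    rw [pair_two_mul h, ← mul_add, pair_two_mul h, neg_one_zpow_add]
    linear_combination (-1) ^ c * neg_one_zpow_mul_self i
  have h1 : HasMean (fun i => pair a b (2 * i + 1) * pair a b (2 * i + 1 + 2 * c))
      ((-1) ^ c * v) := by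
    refine (hv.mul_left _).congr_off {-1, -1 - c} fun i hi => ?_
    simp only [Finset.mem_insert, Finset.mem_singleton, not_or] at hi
    rw [show 2 * i + 1 + 2 * c = 2 * (i + c) + 1 by ring, pair_two_mul_add_one h hi.1,
      pair_two_mul_add_one h (by omega), neg_one_zpow_add]
    linear_combination (-1) ^ c * pair a b i * pair a b (i + c) * neg_one_zpow_mul_self i
  have := HasMean.of_halves (f := fun i => pair a b i * pair a b (i + 2 * c))
    (abs_pair_mul_pair _) h0 h1
  rwa [← mul_one_add] at this

/-- The first doubling, of an odd shift, gives -1/2 = 1 - 3/2; each later one has c even and halves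
the distance to 1. -/
theorem hasMean_pair_mul_pair (h : IsLegalSeed a b) (ℓ : ℤ) (n : ℕ) :
    HasMean (fun i => pair a b i * pair a b (i + 2 ^ (n + 1) * (2 * ℓ + 1)))
      (1 - 3 / 2 ^ (n + 1)) := by
  induction n with
  | zero =>
    have := hasMean_pair_mul_pair_even h (hasMean_pair_mul_pair_odd h ℓ)
    rw [neg_one_zpow_two_mul_add_one] at this
    convert this using 1 <;> norm_num
  | succ n ih =>
    have := hasMean_pair_mul_pair_even h ih
    have hs : (-1 : ℝ) ^ ((2 : ℤ) ^ (n + 1) * (2 * ℓ + 1)) = 1 := by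
      rw [pow_succ', mul_assoc, neg_one_zpow_two_mul]
    rw [hs, ← mul_assoc, ← pow_succ'] at this
    convert this using 1
    rw [pow_succ' _ (n + 1)]
    field_simp
    ring

/-! ### Fourfold products under doubling of the shifts. -/

/-- The product of the letters of the word at `i`, `i + m₁`, `i + m₂`, `i + m₃`. -/
noncomputable def corr (a b : Fin 4) (m : Fin 3 → ℤ) (i : ℤ) : ℝ :=
  word a b i * ∏ j, word a b (i + m j)

theorem corr_eq (m : Fin 3 → ℤ) (i : ℤ) :
    corr a b m i =
      word a b i * (word a b (i + m 0) * word a b (i + m 1) * word a b (i + m 2)) := by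
  rw [corr, Fin.prod_univ_three]

theorem abs_corr (m : Fin 3 → ℤ) (i : ℤ) : |corr a b m i| = 1 := by
  simp only [corr_eq, abs_mul, abs_word, mul_one]

theorem abs_neg_one_zpow_mul_corr (m : Fin 3 → ℤ) (i : ℤ) : |(-1) ^ i * corr a b m i| = 1 := by
  rw [abs_mul, abs_neg_one_zpow, abs_corr, mul_one]

/-- The positions near the origin at which the halves of the word may mix. -/
noncomputable def exceptional (m : Fin 3 → ℤ) : Finset ℤ :=
  Finset.univ.biUnion fun j => Finset.Icc (-|m j|) |m j|

theorem halfSign_add_of_not_mem {m : Fin 3 → ℤ} {i : ℤ} (hi : i ∉ exceptional m) (j : Fin 3) :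
    halfSign (i + m j) = halfSign i :=
  halfSign_add fun h => hi (Finset.mem_biUnion.2 ⟨j, Finset.mem_univ j, h⟩)

theorem corr_two_smul_two_mul (h : IsLegalSeed a b) {m : Fin 3 → ℤ} {i : ℤ}
    (hi : i ∉ exceptional m) : corr a b ((2 : ℤ) • m) (2 * i) = corr a b m i := by
  simp only [corr_eq, Pi.smul_apply, smul_eq_mul, ← mul_add, word_two_mul h,
    halfSign_add_of_not_mem hi]
  linear_combination word a b i * (word a b (i + m 0) * word a b (i + m 1) * word a b (i + m 2)) *
    (halfSign i * halfSign i + 1) * halfSign_mul_self i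

/-- The four half signs cancel away from the origin, and the four alternating signs multiply to
(-1)^(m 0 + m 1 + m 2) = 1. -/
theorem corr_two_smul_two_mul_add_one (h : IsLegalSeed a b) {m : Fin 3 → ℤ} {i : ℤ}
    (hm : Even (m 0 + m 1 + m 2)) (hi : i ∉ exceptional m) :
    corr a b ((2 : ℤ) • m) (2 * i + 1) = corr a b m i := by
  have e : ∀ j, 2 * i + 1 + 2 * m j = 2 * (i + m j) + 1 := fun j => by ring
  have h1 : (-1 : ℝ) ^ i * (-1) ^ (i + m 0) * (-1) ^ (i + m 1) * (-1) ^ (i + m 2) = 1 := by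
    simp only [← neg_one_zpow_add]
    refine Even.neg_one_zpow ?_
    rw [show i + (i + m 0) + (i + m 1) + (i + m 2) = 2 * (2 * i) + (m 0 + m 1 + m 2) by ring]
    exact (even_two_mul _).add hm
  simp only [corr_eq, Pi.smul_apply, smul_eq_mul, e, word_two_mul_add_one h,
    halfSign_add_of_not_mem hi]
  linear_combination word a b i * (word a b (i + m 0) * word a b (i + m 1) * word a b (i + m 2)) *
    ((halfSign i * halfSign i) ^ 2 * h1 + (halfSign i * halfSign i + 1) * halfSign_mul_self i)

theorem hasMean_corr_two_smul (h : IsLegalSeed a b) {m : Fin 3 → ℤ} {v : ℝ}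
    (hm : Even (m 0 + m 1 + m 2)) (hv : HasMean (corr a b m) v) :
    HasMean (corr a b ((2 : ℤ) • m)) v := by
  have := HasMean.of_halves (f := corr a b ((2 : ℤ) • m)) (fun i => (abs_corr _ i).le)
    (hv.congr_off _ fun i hi => corr_two_smul_two_mul h hi)
    (hv.congr_off _ fun i hi => corr_two_smul_two_mul_add_one h hm hi)
  rwa [add_self_div_two] at this

/-- Even and odd positions carry the same product, so the alternating sign cancels them. -/
theorem hasMean_neg_one_zpow_mul_corr_two_smul (h : IsLegalSeed a b) {m : Fin 3 → ℤ} {v : ℝ}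
    (hm : Even (m 0 + m 1 + m 2)) (hv : HasMean (corr a b m) v) :
    HasMean (fun i => (-1) ^ i * corr a b ((2 : ℤ) • m) i) 0 := by
  have := HasMean.of_halves (f := fun i => (-1) ^ i * corr a b ((2 : ℤ) • m) i)
    (fun i => (abs_neg_one_zpow_mul_corr _ i).le)
    (hv.congr_off (exceptional m) fun i hi => by
      rw [neg_one_zpow_two_mul, corr_two_smul_two_mul h hi, one_mul])
    ((hv.mul_left (-1)).congr_off (exceptional m) fun i hi => by
      rw [neg_one_zpow_two_mul_add_one, corr_two_smul_two_mul_add_one h hm hi])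
  simpa using this

theorem hasMean_corr_two_pow_smul (h : IsLegalSeed a b) {μ : Fin 3 → ℤ} {v : ℝ}
    (hμ : Even (μ 0 + μ 1 + μ 2)) (hv : HasMean (corr a b μ) v) (m : ℕ) :
    HasMean (corr a b ((2 : ℤ) ^ m • μ)) v := by
  induction m with
  | zero => simpa using hv
  | succ m ih =>
    rw [pow_succ', mul_smul]
    refine hasMean_corr_two_smul h ?_ ih
    simp only [Pi.smul_apply, smul_eq_mul, ← mul_add]
    exact hμ.mul_left _

theorem hasMean_neg_one_zpow_mul_corr_two_pow_smul (h : IsLegalSeed a b) {μ : Fin 3 → ℤ}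
    {v u : ℝ} (hμ : Even (μ 0 + μ 1 + μ 2)) (hv : HasMean (corr a b μ) v)
    (hu : HasMean (fun i => (-1) ^ i * corr a b μ i) u) (m : ℕ) :
    HasMean (fun i => (-1) ^ i * corr a b ((2 : ℤ) ^ m • μ) i) ((if m = 0 then 1 else 0) * u) := by
  cases m with
  | zero => simpa using hu
  | succ m =>
    rw [pow_succ', mul_smul, if_neg m.succ_ne_zero, zero_mul]
    refine hasMean_neg_one_zpow_mul_corr_two_smul h ?_ (hasMean_corr_two_pow_smul h hμ hv m)
    simp only [Pi.smul_apply, smul_eq_mul, ← mul_add]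
    exact hμ.mul_left _

/-! ### The base case: shifts (2, 4K+1, 4K+3), by residue modulo 4. -/

section base

variable (K i : ℤ)

/-- The recursion modulo 4 involves no half sign, so this and the three companion formulas hold
without exceptional positions. -/
theorem corr_four_mul (h : IsLegalSeed a b) :
    corr a b ![2, 4 * K + 1, 4 * K + 3] (4 * i) = -(-1) ^ K := by
  simp only [corr_eq, Matrix.cons_val]
  rw [show 4 * i + (4 * K + 1) = 4 * (i + K) + 1 by ring,
    show 4 * i + (4 * K + 3) = 4 * (i + K) + 3 by ring, word_four_mul h, word_four_mul_add_one h,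
    word_four_mul_add_two h, word_four_mul_add_three h, neg_one_zpow_add]
  linear_combination -(-1) ^ K * (neg_one_zpow_mul_self i + (-1) ^ i * (-1) ^ i *
    (word_mul_self (a := a) (b := b) i +
      word a b i * word a b i * word_mul_self (a := a) (b := b) (i + K)))

theorem corr_four_mul_add_one (h : IsLegalSeed a b) :
    corr a b ![2, 4 * K + 1, 4 * K + 3] (4 * i + 1) = -(-1) ^ K * pair a b (i + K) := by
  simp only [corr_eq, Matrix.cons_val, pair]
  rw [show 4 * i + 1 + 2 = 4 * i + 3 by ring,
    show 4 * i + 1 + (4 * K + 1) = 4 * (i + K) + 2 by ring,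
    show 4 * i + 1 + (4 * K + 3) = 4 * (i + K + 1) by ring, word_four_mul h,
    word_four_mul_add_one h, word_four_mul_add_two h, word_four_mul_add_three h, neg_one_zpow_add]
  linear_combination -(-1) ^ K * word a b (i + K) * word a b (i + K + 1) *
    (neg_one_zpow_mul_self i + (-1) ^ i * (-1) ^ i * word_mul_self (a := a) (b := b) i)

theorem corr_four_mul_add_two (h : IsLegalSeed a b) :
    corr a b ![2, 4 * K + 1, 4 * K + 3] (4 * i + 2) =
      -(-1) ^ K * (pair a b i * pair a b (i + K)) := by
  simp only [corr_eq, Matrix.cons_val, pair]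
  rw [show 4 * i + 2 + 2 = 4 * (i + 1) by ring,
    show 4 * i + 2 + (4 * K + 1) = 4 * (i + K) + 3 by ring,
    show 4 * i + 2 + (4 * K + 3) = 4 * (i + K + 1) + 1 by ring, word_four_mul h,
    word_four_mul_add_one h, word_four_mul_add_two h, word_four_mul_add_three h, neg_one_zpow_add]
  linear_combination -(-1) ^ K * word a b i * word a b (i + 1) * word a b (i + K) *
    word a b (i + K + 1) * neg_one_zpow_mul_self i

theorem corr_four_mul_add_three (h : IsLegalSeed a b) :
    corr a b ![2, 4 * K + 1, 4 * K + 3] (4 * i + 3) = (-1) ^ K * pair a b i := by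
  simp only [corr_eq, Matrix.cons_val, pair]
  rw [show 4 * i + 3 + 2 = 4 * (i + 1) + 1 by ring,
    show 4 * i + 3 + (4 * K + 1) = 4 * (i + K + 1) by ring,
    show 4 * i + 3 + (4 * K + 3) = 4 * (i + K + 1) + 2 by ring, word_four_mul h,
    word_four_mul_add_one h, word_four_mul_add_two h, word_four_mul_add_three h,
    neg_one_zpow_add_one, neg_one_zpow_add]
  linear_combination (-1) ^ K * word a b i * word a b (i + 1) *
    (neg_one_zpow_mul_self i +
      (-1) ^ i * (-1) ^ i * word_mul_self (a := a) (b := b) (i + K + 1))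

end base

theorem hasMean_corr_even (h : IsLegalSeed a b) {K : ℤ} {A : ℝ}
    (hA : HasMean (fun i => pair a b i * pair a b (i + K)) A) :
    HasMean (fun i => corr a b ![2, 4 * K + 1, 4 * K + 3] (2 * i)) (-(-1) ^ K * (1 + A) / 2) := by
  have := HasMean.of_halves (f := fun i => corr a b ![2, 4 * K + 1, 4 * K + 3] (2 * i))
    (fun i => (abs_corr _ _).le)
    ((hasMean_const (-(-1) ^ K)).congr fun i => by
      rw [← corr_four_mul K i h]; ring_nf)
    ((hA.mul_left (-(-1) ^ K)).congr fun i => by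
      rw [← corr_four_mul_add_two K i h]; ring_nf)
  rwa [← mul_one_add] at this

/-- Residues 1 and 3 leave a single pair, of mean 0; this is why η and θ agree in the base case. -/
theorem hasMean_corr_odd (h : IsLegalSeed a b) (K : ℤ) :
    HasMean (fun i => corr a b ![2, 4 * K + 1, 4 * K + 3] (2 * i + 1)) 0 := by
  have := HasMean.of_halves (f := fun i => corr a b ![2, 4 * K + 1, 4 * K + 3] (2 * i + 1))
    (fun i => (abs_corr _ _).le)
    ((((hasMean_pair h).shift (fun i => (abs_pair i).le) K).mul_left (-(-1) ^ K)).congr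
      fun i => by rw [← corr_four_mul_add_one K i h]; ring_nf)
    (((hasMean_pair h).mul_left ((-1) ^ K)).congr
      fun i => by rw [← corr_four_mul_add_three K i h]; ring_nf)
  simpa using this

theorem hasMean_corr (h : IsLegalSeed a b) {K : ℤ} {A : ℝ}
    (hA : HasMean (fun i => pair a b i * pair a b (i + K)) A) :
    HasMean (corr a b ![2, 4 * K + 1, 4 * K + 3]) (-(-1) ^ K * (1 + A) / 4) := by
  have := HasMean.of_halves (fun i => (abs_corr _ i).le) (hasMean_corr_even h hA)
    (hasMean_corr_odd h K)
  rwa [add_zero, div_div, show (2 : ℝ) * 2 = 4 by norm_num] at this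

theorem hasMean_neg_one_zpow_mul_corr (h : IsLegalSeed a b) {K : ℤ} {A : ℝ}
    (hA : HasMean (fun i => pair a b i * pair a b (i + K)) A) :
    HasMean (fun i => (-1) ^ i * corr a b ![2, 4 * K + 1, 4 * K + 3] i)
      (-(-1) ^ K * (1 + A) / 4) := by
  have := HasMean.of_halves
    (f := fun i => (-1) ^ i * corr a b ![2, 4 * K + 1, 4 * K + 3] i)
    (fun i => (abs_neg_one_zpow_mul_corr _ i).le)
    ((hasMean_corr_even h hA).congr fun i => by rw [neg_one_zpow_two_mul, one_mul])
    (((hasMean_corr_odd h K).mul_left (-1)).congr fun i => by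
      rw [neg_one_zpow_two_mul_add_one])
  rwa [mul_zero, add_zero, div_div, show (2 : ℝ) * 2 = 4 by norm_num] at this

/-- For n = 0 the shift is odd, with A = 0 and leading sign +; for n > 0 it is even and the sign is
-. One formula covers both cases. -/
theorem exists_hasMean_pair_mul_pair (h : IsLegalSeed a b) (ℓ : ℤ) (n : ℕ) :
    ∃ A, HasMean (fun i => pair a b i * pair a b (i + 2 ^ n * (2 * ℓ + 1))) A ∧
      -(-1) ^ ((2 : ℤ) ^ n * (2 * ℓ + 1)) * (1 + A) / 4 = -(1 / 2) + 3 / 2 ^ (n + 2) := by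
  cases n with
  | zero =>
    refine ⟨0, by simpa using hasMean_pair_mul_pair_odd h ℓ, ?_⟩
    rw [pow_zero, one_mul, neg_one_zpow_two_mul_add_one]
    norm_num
  | succ n =>
    refine ⟨_, hasMean_pair_mul_pair h ℓ n, ?_⟩
    rw [pow_succ' (2 : ℤ), mul_assoc, neg_one_zpow_two_mul, pow_add _ (n + 1) 2]
    field_simp
    ring

theorem hasMean_corr_add (h : IsLegalSeed a b) (ℓ : ℤ) (n : ℕ) :
    HasMean (corr a b ![2, 2 ^ (n + 2) * (2 * ℓ + 1) + 1, 2 ^ (n + 2) * (2 * ℓ + 1) + 3])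
      (-(1 / 2) + 3 / 2 ^ (n + 2)) ∧
    HasMean (fun i => (-1) ^ i *
      corr a b ![2, 2 ^ (n + 2) * (2 * ℓ + 1) + 1, 2 ^ (n + 2) * (2 * ℓ + 1) + 3] i)
      (-(1 / 2) + 3 / 2 ^ (n + 2)) := by
  obtain ⟨A, hA, hv⟩ := exists_hasMean_pair_mul_pair h ℓ n
  rw [← hv, show (2 : ℤ) ^ (n + 2) * (2 * ℓ + 1) = 4 * (2 ^ n * (2 * ℓ + 1)) by ring]
  exact ⟨hasMean_corr h hA, hasMean_neg_one_zpow_mul_corr h hA⟩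

/-! ### The second family, by translation. -/

theorem corr_neg_shift (k i : ℤ) :
    corr a b ![2, k - 1, k + 1] i = corr a b ![2, -k + 1, -k + 3] (i + (k - 1)) := by
  simp only [corr_eq, Matrix.cons_val]
  rw [show i + (k - 1) + 2 = i + (k + 1) by ring, show i + (k - 1) + (-k + 1) = i by ring,
    show i + (k - 1) + (-k + 3) = i + 2 by ring]
  ring

theorem hasMean_corr_sub (h : IsLegalSeed a b) (ℓ : ℤ) (n : ℕ) :
    HasMean (corr a b ![2, 2 ^ (n + 2) * (2 * ℓ + 1) - 1, 2 ^ (n + 2) * (2 * ℓ + 1) + 1])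
      (-(1 / 2) + 3 / 2 ^ (n + 2)) ∧
    HasMean (fun i => (-1) ^ i *
      corr a b ![2, 2 ^ (n + 2) * (2 * ℓ + 1) - 1, 2 ^ (n + 2) * (2 * ℓ + 1) + 1] i)
      (-(-(1 / 2) + 3 / 2 ^ (n + 2))) := by
  -- The choice -ℓ - 1 turns 2ℓ + 1 into its negative.
  obtain ⟨h0, h1⟩ := hasMean_corr_add h (-ℓ - 1) n
  have hk : (2 : ℤ) ^ (n + 2) * (2 * (-ℓ - 1) + 1) = -(2 ^ (n + 2) * (2 * ℓ + 1)) := by ring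
  have he : Even ((2 : ℤ) ^ (n + 2) * (2 * ℓ + 1)) := by
    rw [pow_succ', mul_assoc]
    exact even_two_mul _
  rw [hk] at h0 h1
  generalize (2 : ℤ) ^ (n + 2) * (2 * ℓ + 1) = k at *
  refine ⟨(h0.shift (fun i => (abs_corr _ i).le) (k - 1)).congr (corr_neg_shift k), ?_⟩
  rw [← neg_one_mul (_ + _)]
  refine ((h1.shift (fun i => (abs_neg_one_zpow_mul_corr _ i).le) (k - 1)).mul_left (-1)).congr
    fun i => ?_
  -- Since k is even, the translation distance k - 1 is odd and contributes the sign -1.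
  rw [corr_neg_shift, neg_one_zpow_add, (he.sub_odd odd_one).neg_one_zpow]
  ring

end word
end RudinShapiro

theorem mainTheorem11 (a b : Fin 4) (hab : RudinShapiro.IsLegalSeed a b) (ℓ : ℤ) (m n : ℕ) :
    RudinShapiro.HasEta (RudinShapiro.word a b)
      ((2 : ℤ) ^ m • ![2, 2 ^ (n + 2) * (2 * ℓ + 1) + 1, 2 ^ (n + 2) * (2 * ℓ + 1) + 3])
      (-(1 / 2) + 3 / 2 ^ (n + 2)) ∧
    RudinShapiro.HasTheta (RudinShapiro.word a b)
      ((2 : ℤ) ^ m • ![2, 2 ^ (n + 2) * (2 * ℓ + 1) + 1, 2 ^ (n + 2) * (2 * ℓ + 1) + 3])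
      ((if m = 0 then 1 else 0) * (-(1 / 2) + 3 / 2 ^ (n + 2))) ∧
    RudinShapiro.HasEta (RudinShapiro.word a b)
      ((2 : ℤ) ^ m • ![2, 2 ^ (n + 2) * (2 * ℓ + 1) - 1, 2 ^ (n + 2) * (2 * ℓ + 1) + 1])
      (-(1 / 2) + 3 / 2 ^ (n + 2)) ∧
    RudinShapiro.HasTheta (RudinShapiro.word a b)
      ((2 : ℤ) ^ m • ![2, 2 ^ (n + 2) * (2 * ℓ + 1) - 1, 2 ^ (n + 2) * (2 * ℓ + 1) + 1])
      (-((if m = 0 then 1 else 0) * (-(1 / 2) + 3 / 2 ^ (n + 2)))) := by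
  obtain ⟨h0, h1⟩ := RudinShapiro.hasMean_corr_add hab ℓ n
  obtain ⟨h2, h3⟩ := RudinShapiro.hasMean_corr_sub hab ℓ n
  rw [← mul_neg]
  generalize (2 : ℤ) ^ (n + 2) * (2 * ℓ + 1) = k at *
  -- The shifts sum to 2k + 6 here and to 2k + 2 below, which are even for every k.
  have e0 : Even (![2, k + 1, k + 3] 0 + ![2, k + 1, k + 3] 1 + ![2, k + 1, k + 3] 2) :=
    ⟨k + 3, by simp only [Matrix.cons_val]; ring⟩
  have e1 : Even (![2, k - 1, k + 1] 0 + ![2, k - 1, k + 1] 1 + ![2, k - 1, k + 1] 2) :=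
    ⟨k + 1, by simp only [Matrix.cons_val]; ring⟩
  exact ⟨RudinShapiro.hasMean_corr_two_pow_smul hab e0 h0 m,
    RudinShapiro.hasMean_neg_one_zpow_mul_corr_two_pow_smul hab e0 h0 h1 m,
    RudinShapiro.hasMean_corr_two_pow_smul hab e1 h2 m,
    RudinShapiro.hasMean_neg_one_zpow_mul_corr_two_pow_smul hab e1 h2 h3 m⟩
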